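/- **Lemma 2 (Asymptotic distribution of the NP-statistics).** Let $k\ge 2$ and let $(x_t)_{t\ge 1}$ be a (strictly) stationary sequence of random variables with values in the finite alphabet $A=\{0,1,\dots,s-1\}$, in which every symbol has positive probability: $p_a=\mathbb P(x_1=a)>0$ for all $a\in A$. The $p_a$ need not be equal. Assume the hypothesis of unpredictability $\mathcal H_0$: for every $t$, the symbol $x_t$ is independent of its past $(x_1,\dots,x_{t-1})$. For $n\ge k$, $i=(i_1,\dots,i_{k-1})\in A^{k-1}$ and $j\in A$ put $$f_{ij}=\sum_{t=1}^{n-k+1} I\big((x_t,\dots,x_{t+k-2})=i\big)\,I\big(x_{t+k-1}=j\big),\qquad f_{i\cdot}=\sum_{j\in A} f_{ij},\qquad f_{\cdot j}=\sum_{i\in A^{k-1}} f_{ij},$$ where $I$ denotes the indicator. Then, for fixed $s$ and $k$, as $n\to\infty$, $$D_n=2\sum_{i\in A^{k-1}}\sum_{j\in A} f_{ij}\,\ln\frac{(n-k+1)\,f_{ij}}{f_{\cdot j}\,f_{i\cdot}}\ \xrightarrow{\ d\ }\ \chi^2\big((s^{k-1}-1)(s-1)\big),$$ where terms with $f_{ij}=0$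 are $0$, and $\chi^2(d)$ is the law of the sum of the squares of $d$ independent standard normal variables (the point mass at $0$ if $d=0$). -/

import Mathlib

open MeasureTheory ProbabilityTheory Filter

noncomputable section

/-- The `χ²` distribution with `d` degrees of freedom: the law of the sum of the squares of `d`
independent standard normal variables (the point mass at `0` when `d = 0`). -/
def chiSquared (d : ℕ) : Measure ℝ :=
  (Measure.pi fun _ : Fin d => gaussianReal 0 1).map fun z => ∑ r, z r ^ 2

instance isProbabilityMeasure_chiSquared (d : ℕ) : IsProbabilityMeasure (chiSquared d) :=
  Measure.isProbabilityMeasure_map (by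
    have h : Measurable fun z : Fin d → ℝ => ∑ r, z r ^ 2 := by fun_prop
    exact h.aemeasurable)

/-- (Strict) stationarity: the law of the whole process is invariant under time shifts. -/
def IsStationaryProcess {Ω E : Type*} [MeasurableSpace Ω] [MeasurableSpace E]
    (X : ℕ → Ω → E) (μ : Measure Ω) : Prop :=
  ∀ h : ℕ, IdentDistrib (fun ω (t : ℕ) => X (t + h) ω) (fun ω (t : ℕ) => X t ω) μ μ

/-- The hypothesis of unpredictability: each new symbol `X t` is independent of the prior history
`(X 0, …, X (t - 1))`. -/
def IsUnpredictable {Ω E : Type*} [MeasurableSpace Ω] [MeasurableSpace E]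
    (X : ℕ → Ω → E) (μ : Measure Ω) : Prop :=
  ∀ t : ℕ, IndepFun (fun ω (u : Fin t) => X u ω) (X t) μ

/-- `f_ij`: the number of positions in the word `x 0, …, x (n - 1)` at which the block `i` of
`k - 1` symbols occurs and is followed by the symbol `j`. Overlaps are allowed: the starting
position runs through all `n - k + 1` windows of length `k`. -/
def blockCount {s : ℕ} (k n : ℕ) (x : ℕ → Fin s) (i : Fin (k - 1) → Fin s) (j : Fin s) : ℕ :=
  ∑ t ∈ Finset.range (n + 1 - k),
    if (∀ l : Fin (k - 1), x (t + l) = i l) ∧ x (t + (k - 1)) = j then 1 else 0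

/-- `f_i· = ∑_j f_ij`. -/
def rowCount {s : ℕ} (k n : ℕ) (x : ℕ → Fin s) (i : Fin (k - 1) → Fin s) : ℕ :=
  ∑ j, blockCount k n x i j

/-- `f_·j = ∑_i f_ij`. -/
def colCount {s : ℕ} (k n : ℕ) (x : ℕ → Fin s) (j : Fin s) : ℕ :=
  ∑ i, blockCount k n x i j

/-- The Neyman–Pearson statistic
`D = 2 ∑_ij f_ij ln ((n - k + 1) f_ij / (f_·j f_i·))` of the word `x 0, …, x (n - 1)`.
Terms with `f_ij = 0` contribute `0`. -/
def npStatistic {s : ℕ} (k n : ℕ) (x : ℕ → Fin s) : ℝ :=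
  2 * ∑ i : Fin (k - 1) → Fin s, ∑ j : Fin s, (blockCount k n x i j : ℝ) *
    Real.log (((n : ℝ) - k + 1) * blockCount k n x i j / (colCount k n x j * rowCount k n x i))

end

/-! Write `d = k - 1`, and let `p j` and `q i` be the probabilities of a symbol `j` and of a block
`i` of length `d`. Let `F i j` count the occurrences of `i` followed by `j` among the first `N`
windows of length `d + 1`, with row sums `R i`.

**Central limit theorem.** The windows overlap, so the summands are not independent, but if `c i ·`
has mean `0` for every `i`, then `∑ c i j * F i j` is a martingale: the last symbol of a window is
independent of everything before it. Given the past, the characteristic function of the next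
increment depends only on the current block, so the product of these conditional characteristic
functions over the windows is `∏ φ i ^ R i`. Dividing `exp (I * S / √N)` by it gives a random
variable with mean `1` (`integral_exp_windowSum_eq_one`), while the product itself converges
in probability to a Gaussian characteristic function because `R i / N` converges to `q i`
(`tendstoInMeasure_blockFreq`, again by a martingale estimate, extending the block symbol by
symbol). The conclusion is `tendsto_integral_exp_windowSum`.

**Expansion.** Since the rows of `F i j - R i * p j` sum to `0`, the statistic is the likelihood
ratio of `F i j` against `R i * p j` minus that of the column sums against `N * p j`
(`likelihoodRatio_eq`), and it is a continuous function of `y i j = (F i j - R i * p j) / √N`, of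
`R i / N` and of `1 / √N` near `(·, q, 0)`. By Slutsky's theorem and the continuous mapping theorem
its limit is the law of `∑ y i j ^ 2 / (q i * p j) - ∑ j, (∑ i, y i j) ^ 2 / p j` in the Gaussian
limit.

**Counting degrees of freedom.** Take orthonormal bases `a` of the space of functions on blocks
and `b` of that of functions on symbols, with `a 0 = √q` and `b 0 = √p`. The table `y i j / √(q i
* p j)` is orthogonal to `b 0` in each row, and its remaining coordinates in the products `a k i *
b l j` converge to independent standard normal variables (`tendstoInDistribution_countCoords`).
The quadratic form is the sum of the squares of the coordinates with `k ≠ 0` and `l ≠ 0`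
(`sum_sq_sub_sum_sq_tableOfCoords`), of which there are `(s ^ d - 1) * (s - 1)`. -/

open scoped Topology

noncomputable section

variable {Ω : Type*} [MeasurableSpace Ω] {μ : Measure Ω} {s : ℕ} {X : ℕ → Ω → Fin s}

/-! ### Averaging out the newest symbol -/

lemma sum_measureReal_eq_one [IsProbabilityMeasure μ] (hX : ∀ t, Measurable (X t))
    {p : Fin s → ℝ} (hp : ∀ t a, μ.real {ω | X t ω = a} = p a) : ∑ a, p a = 1 := by
  have h := sum_measureReal_preimage_singleton (μ := μ) (f := X 0) Finset.univ
    fun a _ => hX 0 (measurableSet_singleton a)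
  simp only [Finset.coe_univ, Set.preimage_univ, probReal_univ] at h
  rw [← h]
  exact Finset.sum_congr rfl fun a _ => (hp 0 a).symm

lemma exists_eq_comp_of_dependsOn_Iio {β : Type*} [Nonempty (Fin s)] {Φ : (ℕ → Fin s) → β} {t : ℕ}
    (hΦ : DependsOn Φ (Set.Iio t)) :
    ∃ g : (Fin t → Fin s) → β, ∀ x : ℕ → Fin s, Φ x = g fun u => x u := by
  refine ⟨fun v => Φ fun u => if h : u < t then v ⟨u, h⟩ else Classical.arbitrary _, fun x => ?_⟩
  refine hΦ fun u hu => ?_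
  simp only [Set.mem_Iio] at hu
  simp [hu]

lemma measurable_of_dependsOn_Iio {β : Type*} [MeasurableSpace β] (hX : ∀ t, Measurable (X t))
    {Φ : (ℕ → Fin s) → β} {t : ℕ} (hΦ : DependsOn Φ (Set.Iio t)) :
    Measurable fun ω => Φ fun u => X u ω := by
  rcases isEmpty_or_nonempty Ω with h | ⟨⟨ω⟩⟩
  · exact measurable_of_empty _
  have : Nonempty (Fin s) := ⟨X 0 ω⟩
  obtain ⟨g, hg⟩ := exists_eq_comp_of_dependsOn_Iio hΦ
  simp only [hg]
  exact (Measurable.of_discrete (f := g)).comp (measurable_pi_lambda _ fun u => hX u)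

lemma integrable_of_dependsOn_Iio [IsProbabilityMeasure μ] {E : Type*} [NormedAddCommGroup E]
    [MeasurableSpace E] [BorelSpace E] [SecondCountableTopology E]
    (hX : ∀ t, Measurable (X t)) {Φ : (ℕ → Fin s) → E} {t : ℕ} (hΦ : DependsOn Φ (Set.Iio t)) :
    Integrable (fun ω => Φ fun u => X u ω) μ := by
  have : Nonempty Ω := μ.nonempty_of_neZero
  have : Nonempty (Fin s) := ⟨X 0 (Classical.arbitrary Ω)⟩
  obtain ⟨g, hg⟩ := exists_eq_comp_of_dependsOn_Iio hΦ
  refine Integrable.of_bound (measurable_of_dependsOn_Iio hX hΦ).aestronglyMeasurable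
    (∑ v, ‖g v‖) (ae_of_all _ fun ω => ?_)
  rw [hg]
  exact Finset.single_le_sum (f := fun v => ‖g v‖) (fun _ _ => norm_nonneg _) (Finset.mem_univ _)

/-- Under unpredictability the newest symbol may be averaged out: the expectation of a function of
the past and of `X t` does not change when `X t` is replaced by an independent copy. -/
lemma integral_eq_integral_sum_of_isUnpredictable [IsProbabilityMeasure μ] {E : Type*}
    [NormedAddCommGroup E] [NormedSpace ℝ E] [CompleteSpace E] (hX : ∀ t, Measurable (X t))
    (hH0 : IsUnpredictable X μ)
    {p : Fin s → ℝ} (hp : ∀ t a, μ.real {ω | X t ω = a} = p a) (t : ℕ)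
    {Φ : (ℕ → Fin s) → Fin s → E} (hΦ : DependsOn Φ (Set.Iio t)) :
    ∫ ω, Φ (fun u => X u ω) (X t ω) ∂μ = ∫ ω, ∑ a, p a • Φ (fun u => X u ω) a ∂μ := by
  have : Nonempty Ω := μ.nonempty_of_neZero
  have : Nonempty (Fin s) := ⟨X 0 (Classical.arbitrary Ω)⟩
  obtain ⟨g, hg⟩ := exists_eq_comp_of_dependsOn_Iio hΦ
  simp only [hg]
  have hY : Measurable fun ω (u : Fin t) => X u ω := measurable_pi_lambda _ fun u => hX u
  have hlaw := (indepFun_iff_map_prod_eq_prod_map_map hY.aemeasurable (hX t).aemeasurable).1 (hH0 t)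
  have := Measure.isProbabilityMeasure_map (μ := μ) hY.aemeasurable
  have := Measure.isProbabilityMeasure_map (μ := μ) (hX t).aemeasurable
  calc ∫ ω, g (fun u => X u ω) (X t ω) ∂μ
      = ∫ z, g z.1 z.2 ∂(μ.map fun ω => (fun u : Fin t => X u ω, X t ω)) := by
        rw [integral_map (hY.prodMk (hX t)).aemeasurable]
        exact .of_discrete
    _ = ∫ y, ∑ a, p a • g y a ∂(μ.map fun ω (u : Fin t) => X u ω) := by
        rw [hlaw, integral_prod _ Integrable.of_finite]
        refine integral_congr_ae (ae_of_all _ fun y => ?_)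
        simp only
        rw [integral_fintype Integrable.of_finite]
        refine Finset.sum_congr rfl fun a _ => ?_
        rw [map_measureReal_apply (hX t) (measurableSet_singleton a), ← hp t a]
        rfl
    _ = _ := by
        rw [integral_map hY.aemeasurable]
        exact .of_discrete

/-! ### Sums over windows -/

/-- The sum of `g i j` over the first `N` windows of length `d + 1` of the word `x`, where `i` is
the block of the first `d` symbols of the window and `j` is its last symbol. -/
def windowSum {E : Type*} [AddCommMonoid E] (d : ℕ) (g : (Fin d → Fin s) → Fin s → E) (N : ℕ)
    (x : ℕ → Fin s) : E :=
  ∑ t ∈ Finset.range N, g (fun l => x (t + l)) (x (t + d))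

lemma dependsOn_block (d N : ℕ) :
    DependsOn (fun (x : ℕ → Fin s) (l : Fin d) => x (N + l)) (Set.Iio (N + d)) := by
  intro x y h
  funext l
  exact h _ (by simp)

lemma dependsOn_windowSum {E : Type*} [AddCommMonoid E] (d : ℕ)
    (g : (Fin d → Fin s) → Fin s → E) (N : ℕ) :
    DependsOn (windowSum d g N) (Set.Iio (N + d)) := by
  intro x y h
  refine Finset.sum_congr rfl fun t ht => ?_
  rw [Finset.mem_range] at ht
  rw [h (t + d) (by simpa using ht)]
  congr 1
  funext l
  exact h _ (by simp only [Set.mem_Iio]; omega)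

/-- If `exp (g i ·)` has mean `1` for every block `i`, then the exponentials of the window sums of
`g` form a martingale with mean `1`. -/
lemma integral_exp_windowSum_eq_one [IsProbabilityMeasure μ] (hX : ∀ t, Measurable (X t))
    (hH0 : IsUnpredictable X μ)
    {p : Fin s → ℝ} (hp : ∀ t a, μ.real {ω | X t ω = a} = p a) (d : ℕ)
    {g : (Fin d → Fin s) → Fin s → ℂ} (hg : ∀ i, ∑ j, p j * Complex.exp (g i j) = 1) (N : ℕ) :
    ∫ ω, Complex.exp (windowSum d g N fun u => X u ω) ∂μ = 1 := by
  induction N with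
  | zero => simp [windowSum]
  | succ N ih =>
    have key := integral_eq_integral_sum_of_isUnpredictable hX hH0 hp (N + d)
      (Φ := fun x a => Complex.exp (windowSum d g N x) * Complex.exp (g (fun l => x (N + l)) a))
      (fun x y h => by
        funext a
        simp only [dependsOn_windowSum d g N h]
        rw [show (fun l : Fin d => x (N + l)) = _ from dependsOn_block d N h])
    calc _ = _ := by
          refine Eq.trans ?_ key
          simp only [windowSum, Finset.sum_range_succ, Complex.exp_add]
      _ = ∫ ω, Complex.exp (windowSum d g N fun u => X u ω) ∂μ := by
          refine integral_congr_ae (ae_of_all _ fun ω => ?_)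
          simp only [Complex.real_smul]
          conv_rhs => rw [← mul_one (Complex.exp (windowSum d g N fun u => X u ω)),
            ← hg (fun l => X (N + l) ω), Finset.mul_sum]
          exact Finset.sum_congr rfl fun a _ => by ring
      _ = 1 := ih

/-- The window sums of a function that is centred in its last argument and bounded by `1` are a
martingale with increments bounded by `1`, so that their second moment grows at most linearly. -/
lemma integral_windowSum_sq_le [IsProbabilityMeasure μ] (hX : ∀ t, Measurable (X t))
    (hH0 : IsUnpredictable X μ)
    {p : Fin s → ℝ} (hp : ∀ t a, μ.real {ω | X t ω = a} = p a) (d : ℕ)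
    {g : (Fin d → Fin s) → Fin s → ℝ} (hg : ∀ i, ∑ j, p j * g i j = 0)
    (hg1 : ∀ i j, |g i j| ≤ 1) (N : ℕ) :
    ∫ ω, windowSum d g N (fun u => X u ω) ^ 2 ∂μ ≤ N := by
  have : Nonempty Ω := μ.nonempty_of_neZero
  have hp0 : ∀ a, 0 ≤ p a := fun a => hp 0 a ▸ measureReal_nonneg
  have hp1 : ∑ a, p a = 1 := sum_measureReal_eq_one hX hp
  induction N with
  | zero => simp [windowSum]
  | succ N ih =>
    have key := integral_eq_integral_sum_of_isUnpredictable hX hH0 hp (N + d)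
      (Φ := fun x a => (windowSum d g N x + g (fun l => x (N + l)) a) ^ 2)
      (fun x y h => by
        funext a
        simp only [dependsOn_windowSum d g N h]
        rw [show (fun l : Fin d => x (N + l)) = _ from dependsOn_block d N h])
    have hint : Integrable (fun ω => windowSum d g N (fun u => X u ω) ^ 2) μ :=
      integrable_of_dependsOn_Iio (Φ := fun x => windowSum d g N x ^ 2) (t := N + d) hX
        fun x y h => by simp only [dependsOn_windowSum d g N h]
    calc _ = ∫ ω, ∑ a, p a • (windowSum d g N (fun u => X u ω) +
            g (fun l => X (N + l) ω) a) ^ 2 ∂μ := by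
          refine Eq.trans ?_ key
          simp only [windowSum, Finset.sum_range_succ]
      _ ≤ ∫ ω, (windowSum d g N (fun u => X u ω) ^ 2 + 1) ∂μ := by
          refine integral_mono
            (integrable_of_dependsOn_Iio (t := N + d) (Φ := fun x => ∑ a, p a •
              (windowSum d g N x + g (fun l => x (N + l)) a) ^ 2) hX fun x y h => ?_)
            (hint.add (integrable_const 1)) fun ω => ?_
          · simp only [dependsOn_windowSum d g N h]
            rw [show (fun l : Fin d => x (N + l)) = _ from dependsOn_block d N h]
          simp only [smul_eq_mul]
          set S := windowSum d g N fun u => X u ω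
          set i : Fin d → Fin s := fun l => X (N + l) ω
          calc ∑ a, p a * (S + g i a) ^ 2
              = S ^ 2 * ∑ a, p a + 2 * S * ∑ a, p a * g i a + ∑ a, p a * g i a ^ 2 := by
                simp only [Finset.mul_sum, ← Finset.sum_add_distrib]
                exact Finset.sum_congr rfl fun a _ => by ring
            _ ≤ S ^ 2 * 1 + 2 * S * 0 + ∑ a, p a := by
                have h : ∑ a, p a * g i a ^ 2 ≤ ∑ a, p a := Finset.sum_le_sum fun a _ =>
                  mul_le_of_le_one_right (hp0 a) ((sq_le_one_iff_abs_le_one _).2 (hg1 i a))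
                rw [hg]
                exact add_le_add (by rw [hp1]) h
            _ = S ^ 2 + 1 := by rw [hp1]; ring
      _ ≤ _ := by
          rw [integral_add hint (integrable_const 1)]
          simpa using ih

/-! ### The law of large numbers for blocks -/

/-- The relative frequency of every block of length `m` converges in mean square to its
probability. The proof extends the block by one symbol at a time: given the count of the shorter
block, the count of the longer one is predicted up to a martingale. -/
lemma tendsto_integral_blockFreq_sub_sq [IsProbabilityMeasure μ] (hX : ∀ t, Measurable (X t))
    (hH0 : IsUnpredictable X μ) {p : Fin s → ℝ} (hp : ∀ t a, μ.real {ω | X t ω = a} = p a)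
    (w : ℕ → Fin s) (m : ℕ) :
    Tendsto (fun N : ℕ => ∫ ω, (windowSum m
      (fun i _ => if i = (fun l : Fin m => w l) then (1 : ℝ) else 0) N (fun u => X u ω) / N
        - ∏ l : Fin m, p (w l)) ^ 2 ∂μ) atTop (𝓝 0) := by
  have hp0 : ∀ a, 0 ≤ p a := fun a => hp 0 a ▸ measureReal_nonneg
  have hp1 : ∀ a, p a ≤ 1 := fun a => hp 0 a ▸ measureReal_le_one
  have hint : ∀ (m N : ℕ) (g : (Fin m → Fin s) → Fin s → ℝ) (c : ℝ),
      Integrable (fun ω => (windowSum m g N (fun u => X u ω) / N - c) ^ 2) μ := fun m N g c =>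
    integrable_of_dependsOn_Iio (Φ := fun x => (windowSum m g N x / N - c) ^ 2) (t := N + m) hX
      fun x y h => by simp only [dependsOn_windowSum m g N h]
  induction m with
  | zero =>
    refine tendsto_const_nhds.congr' ?_
    filter_upwards [eventually_gt_atTop 0] with N hN
    have hN' : (N : ℝ) ≠ 0 := by positivity
    simp [windowSum, hN', Subsingleton.elim _ (fun l : Fin 0 => w l)]
  | succ m ih =>
    set f : (k : ℕ) → (Fin k → Fin s) → Fin s → ℝ :=
      fun k i _ => if i = (fun l : Fin k => w l) then (1 : ℝ) else 0 with hf
    set g : (Fin m → Fin s) → Fin s → ℝ :=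
      fun i j => f m i j * ((if j = w m then 1 else 0) - p (w m)) with hg
    have hsum : ∑ j, p j = 1 := sum_measureReal_eq_one hX hp
    have hg0 : ∀ i, ∑ j, p j * g i j = 0 := fun i => by
      have : ∀ j, p j * g i j = f m i j * ((if j = w m then p j else 0) - p j * p (w m)) :=
        fun j => by simp only [hg]; split_ifs <;> ring
      simp only [this, hf]
      rw [← Finset.mul_sum, Finset.sum_sub_distrib, ← Finset.sum_mul, hsum]
      simp
    have hg1 : ∀ i j, |g i j| ≤ 1 := fun i j => by
      have h0 := hp0 (w m)
      have h1 := hp1 (w m)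
      simp only [hg, hf]
      rw [abs_le]
      split_ifs <;> constructor <;> linarith
    have hdecomp : ∀ (N : ℕ) (x : ℕ → Fin s), windowSum (m + 1) (f (m + 1)) N x =
        windowSum m g N x + p (w m) * windowSum m (f m) N x := fun N x => by
      simp only [windowSum, Finset.mul_sum, ← Finset.sum_add_distrib]
      refine Finset.sum_congr rfl fun t _ => ?_
      have : ((fun l : Fin (m + 1) => x (t + l)) = fun l : Fin (m + 1) => w l) ↔
          ((fun l : Fin m => x (t + l)) = fun l : Fin m => w l) ∧ x (t + m) = w m := by
        simp only [funext_iff, Fin.forall_fin_succ', Fin.val_castSucc, Fin.val_last]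
      simp only [hf, hg, this, ite_and]
      split_ifs <;> ring
    have hbound : ∀ N : ℕ, ∫ ω, (windowSum (m + 1) (f (m + 1)) N (fun u => X u ω) / N
        - ∏ l : Fin (m + 1), p (w l)) ^ 2 ∂μ ≤ 2 * (N : ℝ)⁻¹ +
        2 * ∫ ω, (windowSum m (f m) N (fun u => X u ω) / N - ∏ l : Fin m, p (w l)) ^ 2 ∂μ :=
      fun N => by
      calc _ ≤ ∫ ω, (2 * (windowSum m g N (fun u => X u ω) / N - 0) ^ 2 +
            2 * (windowSum m (f m) N (fun u => X u ω) / N - ∏ l : Fin m, p (w l)) ^ 2) ∂μ := by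
            refine integral_mono (hint _ _ _ _)
              (((hint _ _ _ _).const_mul 2).add ((hint _ _ _ _).const_mul 2)) fun ω => ?_
            simp only [hdecomp, Fin.prod_univ_castSucc, Fin.val_castSucc, Fin.val_last]
            set a := windowSum m g N fun u => X u ω
            set b := windowSum m (f m) N fun u => X u ω
            set P := ∏ l : Fin m, p (w l)
            have h2 : (p (w m) * (b / N - P)) ^ 2 ≤ (b / N - P) ^ 2 := by
              rw [mul_pow]
              exact mul_le_of_le_one_left (sq_nonneg _) (pow_le_one₀ (hp0 _) (hp1 _))
            have h3 : (a + p (w m) * b) / N - P * p (w m) = a / N + p (w m) * (b / N - P) := by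
              ring
            rw [h3]
            nlinarith [sq_nonneg (a / N - p (w m) * (b / N - P))]
        _ = 2 * (∫ ω, windowSum m g N (fun u => X u ω) ^ 2 ∂μ) / N ^ 2 + 2 * ∫ ω,
              (windowSum m (f m) N (fun u => X u ω) / N - ∏ l : Fin m, p (w l)) ^ 2 ∂μ := by
            rw [integral_add ((hint _ _ _ _).const_mul 2) ((hint _ _ _ _).const_mul 2),
              integral_const_mul, integral_const_mul]
            simp only [sub_zero, div_pow, integral_div]
            ring
        _ ≤ _ := by
            refine add_le_add ?_ le_rfl
            rcases Nat.eq_zero_or_pos N with rfl | hN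
            · simp
            have hN' : (0 : ℝ) < N := by exact_mod_cast hN
            rw [div_le_iff₀ (by positivity)]
            have := integral_windowSum_sq_le hX hH0 hp m hg0 hg1 N
            field_simp
            linarith
    refine squeeze_zero (fun N => integral_nonneg fun ω => sq_nonneg _) hbound ?_
    simpa using (tendsto_inv_atTop_nhds_zero_nat (𝕜 := ℝ)).const_mul 2 |>.add (ih.const_mul 2)

/-- The relative frequency of every block converges to its probability in probability. -/
lemma tendstoInMeasure_blockFreq [IsProbabilityMeasure μ] (hX : ∀ t, Measurable (X t))
    (hH0 : IsUnpredictable X μ) {p : Fin s → ℝ} (hp : ∀ t a, μ.real {ω | X t ω = a} = p a)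
    (d : ℕ) :
    TendstoInMeasure μ (fun (N : ℕ) ω (i : Fin d → Fin s) => windowSum d
      (fun i' _ => if i' = i then (1 : ℝ) else 0) N (fun u => X u ω) / N) atTop
      (fun _ i => ∏ l, p (i l)) := by
  have hNe : Nonempty Ω := μ.nonempty_of_neZero
  have hNe' : Nonempty (Fin s) := ⟨X 0 (Classical.arbitrary Ω)⟩
  have hlim : ∀ i : Fin d → Fin s, Tendsto (fun N : ℕ => ∫ ω, (windowSum d
      (fun i' _ => if i' = i then (1 : ℝ) else 0) N (fun u => X u ω) / N
        - ∏ l, p (i l)) ^ 2 ∂μ) atTop (𝓝 0) := fun i => by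
    have h := tendsto_integral_blockFreq_sub_sq hX hH0 hp
      (fun l => if h : l < d then i ⟨l, h⟩ else Classical.arbitrary _) d
    simpa using h
  rw [tendstoInMeasure_iff_measureReal_norm]
  intro ε hε
  have hsum := tendsto_finsetSum Finset.univ fun i (_ : i ∈ Finset.univ) => hlim i
  simp only [Finset.sum_const_zero] at hsum
  have hsum' := hsum.const_mul (ε ^ 2)⁻¹
  rw [mul_zero] at hsum'
  refine squeeze_zero (fun N => measureReal_nonneg) (fun N => ?_) hsum'
  have hint : ∀ i : Fin d → Fin s, Integrable (fun ω => (windowSum d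
      (fun i' _ => if i' = i then (1 : ℝ) else 0) N (fun u => X u ω) / N
        - ∏ l, p (i l)) ^ 2) μ := fun i =>
    integrable_of_dependsOn_Iio (Φ := fun x => (windowSum d
      (fun i' _ => if i' = i then (1 : ℝ) else 0) N x / N - ∏ l, p (i l)) ^ 2) (t := N + d) hX
      fun x y h => by simp only [dependsOn_windowSum d _ N h]
  rw [← integral_finsetSum _ fun i _ => hint i, inv_mul_eq_div, le_div_iff₀' (by positivity)]
  refine le_trans ?_ (mul_meas_ge_le_integral_of_nonneg
    (ae_of_all _ fun ω => Finset.sum_nonneg fun i _ => sq_nonneg _)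
    (integrable_finsetSum _ fun i _ => hint i) (ε ^ 2))
  refine mul_le_mul_of_nonneg_left (measureReal_mono fun ω hω => ?_) (by positivity)
  simp only [Set.mem_ofPred_eq] at hω ⊢
  by_contra! hlt
  refine absurd hω (not_le.2 ((pi_norm_lt_iff hε).2 fun i => ?_))
  rw [Real.norm_eq_abs]
  refine abs_lt_of_sq_lt_sq (lt_of_le_of_lt ?_ hlt) hε.le
  exact Finset.single_le_sum (f := fun i => (windowSum d
      (fun i' _ => if i' = i then (1 : ℝ) else 0) N (fun u => X u ω) / N
        - ∏ l, p (i l)) ^ 2) (fun _ _ => sq_nonneg _) (Finset.mem_univ i)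

/-! ### The central limit theorem for window sums -/

lemma tendsto_inv_sqrt_natCast : Tendsto (fun N : ℕ => (√(N : ℝ))⁻¹) atTop (𝓝 0) :=
  tendsto_inv_atTop_zero.comp (Real.tendsto_sqrt_atTop.comp tendsto_natCast_atTop_atTop)

lemma tendsto_mul_exp_sub_one_sub_self (w : ℂ) :
    Tendsto (fun N : ℕ => (N : ℂ) * (Complex.exp (w * ((√(N : ℝ))⁻¹ : ℝ)) - 1 -
      w * ((√(N : ℝ))⁻¹ : ℝ))) atTop (𝓝 (w ^ 2 / 2)) := by
  set z : ℕ → ℂ := fun N => w * ((√(N : ℝ))⁻¹ : ℝ) with hz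
  have hinv : Tendsto (fun N : ℕ => (((√(N : ℝ))⁻¹ : ℝ) : ℂ)) atTop (𝓝 0) :=
    (Complex.continuous_ofReal.tendsto' 0 0 Complex.ofReal_zero).comp tendsto_inv_sqrt_natCast
  have hz0 : Tendsto z atTop (𝓝 0) := by simpa [hz] using hinv.const_mul w
  have hsq : ∀ N : ℕ, 0 < N → (N : ℂ) * (((√(N : ℝ))⁻¹ : ℝ) : ℂ) ^ 2 = 1 := fun N hN => by
    have : (N : ℝ) * (√(N : ℝ))⁻¹ ^ 2 = 1 := by
      rw [inv_pow, Real.sq_sqrt (Nat.cast_nonneg N)]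
      exact mul_inv_cancel₀ (by positivity)
    exact_mod_cast this
  have hO := (Complex.exp_sub_sum_range_isBigO_pow 3).comp_tendsto hz0
  have hrem : Tendsto (fun N : ℕ => (N : ℂ) * (Complex.exp (z N) -
      ∑ i ∈ Finset.range 3, z N ^ i / (i.factorial : ℂ))) atTop (𝓝 0) := by
    refine ((Asymptotics.isBigO_refl (fun N : ℕ => (N : ℂ)) atTop).mul hO).trans_tendsto ?_
    have h3 : Tendsto (fun N : ℕ => w ^ 3 * (((√(N : ℝ))⁻¹ : ℝ) : ℂ)) atTop (𝓝 0) := by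
      simpa using hinv.const_mul (w ^ 3)
    refine h3.congr' ?_
    filter_upwards [eventually_gt_atTop 0] with N hN
    simp only [Function.comp, hz]
    linear_combination (-(w ^ 3 * (((√(N : ℝ))⁻¹ : ℝ) : ℂ))) * hsq N hN
  have := hrem.add_const (w ^ 2 / 2)
  rw [zero_add] at this
  refine this.congr' ?_
  filter_upwards [eventually_gt_atTop 0] with N hN
  have h := hsq N hN
  simp only [Finset.sum_range_succ, Finset.sum_range_zero, Nat.factorial, hz]
  generalize (((√(N : ℝ))⁻¹ : ℝ) : ℂ) = e at h ⊢
  push_cast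
  linear_combination (-(w ^ 2 / 2)) * h

lemma windowSum_of_block {d : ℕ} (f : (Fin d → Fin s) → ℂ) (N : ℕ) (x : ℕ → Fin s) :
    windowSum d (fun i _ => f i) N x =
      ∑ i, ((windowSum d (fun i' _ => if i' = i then (1 : ℝ) else 0) N x : ℝ) : ℂ) * f i := by
  simp only [windowSum, Complex.ofReal_sum, Finset.sum_mul]
  rw [Finset.sum_comm]
  refine Finset.sum_congr rfl fun t _ => ?_
  rw [Finset.sum_eq_single fun l : Fin d => x (t + l)]
  · simp
  · intro i _ hi
    simp [hi.symm]
  · simp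

lemma blockFreq_mem_Icc {d : ℕ} (i : Fin d → Fin s) (N : ℕ) (x : ℕ → Fin s) :
    windowSum d (fun i' _ => if i' = i then (1 : ℝ) else 0) N x / N ∈ Set.Icc 0 1 := by
  refine ⟨div_nonneg (Finset.sum_nonneg fun t _ => by dsimp only; split_ifs <;> norm_num)
    (Nat.cast_nonneg N),
    div_le_one_of_le₀ ?_ (Nat.cast_nonneg N)⟩
  refine (Finset.sum_le_card_nsmul _ _ 1 fun t _ => by dsimp only; split_ifs <;> norm_num).trans ?_
  simp

/-- **Central limit theorem** for window sums, in terms of characteristic functions. If `c i ·` is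
centred for every block `i`, then `S / √N`, with `S` the window sum of `c`, is asymptotically
normal. With `φ i` the conditional characteristic function of an increment given that the block
is `i`, the quotient of `exp (I * S / √N)` by the product of the `φ` over the windows has mean `1`,
and that product converges in probability to the Gaussian characteristic function by the law of
large numbers for blocks. -/
theorem tendsto_integral_exp_windowSum [IsProbabilityMeasure μ] (hX : ∀ t, Measurable (X t))
    (hH0 : IsUnpredictable X μ) {p : Fin s → ℝ} (hp : ∀ t a, μ.real {ω | X t ω = a} = p a)
    (d : ℕ) {c : (Fin d → Fin s) → Fin s → ℝ} (hc : ∀ i, ∑ j, p j * c i j = 0) :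
    Tendsto (fun N : ℕ => ∫ ω, Complex.exp (Complex.I *
        ((√(N : ℝ))⁻¹ * windowSum d c N (fun u => X u ω) : ℝ)) ∂μ) atTop
      (𝓝 (Complex.exp (∑ i, (∏ l, p (i l) : ℝ) * (-(∑ j, p j * c i j ^ 2 : ℝ) / 2 : ℂ)))) := by
  have hsum : ∑ j, p j = 1 := sum_measureReal_eq_one hX hp
  set φ : (Fin d → Fin s) → ℕ → ℂ := fun i N =>
    ∑ j, p j * Complex.exp ((Complex.I * c i j) * ((√(N : ℝ))⁻¹ : ℝ)) with hφ
  set v : (Fin d → Fin s) → ℂ := fun i => -(∑ j, p j * c i j ^ 2 : ℝ) / 2 with hv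
  -- The conditional characteristic functions are `1 + v / N + o(1 / N)`, with `-2 * v i` the
  -- conditional variance of an increment.
  have hφ1 : ∀ i, Tendsto (fun N : ℕ => (N : ℂ) * (φ i N - 1)) atTop (𝓝 (v i)) := fun i => by
    have h := tendsto_finsetSum Finset.univ fun j (_ : j ∈ Finset.univ) =>
      (tendsto_mul_exp_sub_one_sub_self (Complex.I * c i j)).const_mul (p j : ℂ)
    have hlim : ∑ j, (p j : ℂ) * ((Complex.I * c i j) ^ 2 / 2) = v i := by
      simp only [hv]
      push_cast
      rw [neg_div, Finset.sum_div, ← Finset.sum_neg_distrib]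
      refine Finset.sum_congr rfl fun j _ => ?_
      rw [mul_pow, Complex.I_sq]; ring
    rw [hlim] at h
    refine h.congr fun N => ?_
    have h0 : ∑ j, (p j : ℂ) * c i j = 0 := by exact_mod_cast hc i
    have h1 : ∑ j, (p j : ℂ) = 1 := by exact_mod_cast hsum
    simp only [hφ]
    calc _ = (N : ℂ) * ((∑ j, p j * Complex.exp ((Complex.I * c i j) * ((√(N : ℝ))⁻¹ : ℝ)))
          - ∑ j, (p j : ℂ) - Complex.I * ((√(N : ℝ))⁻¹ : ℝ) * ∑ j, (p j : ℂ) * c i j) := by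
          simp only [Finset.mul_sum, ← Finset.sum_sub_distrib]
          exact Finset.sum_congr rfl fun j _ => by ring
      _ = _ := by rw [h0, h1]; ring
  have hlog : ∀ i, Tendsto (fun N : ℕ => (N : ℂ) * Complex.log (φ i N)) atTop (𝓝 (v i)) :=
    fun i => by simpa using Complex.tendsto_nat_mul_log_one_add_of_tendsto (hφ1 i)
  have hne : ∀ᶠ N : ℕ in atTop, ∀ i, φ i N ≠ 0 := by
    refine eventually_all.2 fun i => ?_
    have h : Tendsto (fun N => φ i N) atTop (𝓝 1) := by
      have h2 := ((hφ1 i).mul (tendsto_inv_atTop_nhds_zero_nat (𝕜 := ℂ))).add_const 1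
      rw [mul_zero, zero_add] at h2
      refine h2.congr' ?_
      filter_upwards [eventually_gt_atTop 0] with N hN
      have : (N : ℂ) ≠ 0 := by exact_mod_cast hN.ne'
      field_simp
      ring
    exact h.eventually_ne one_ne_zero
  set r : ℕ → Ω → (Fin d → Fin s) → ℝ := fun N ω i =>
    windowSum d (fun i' _ => if i' = i then (1 : ℝ) else 0) N (fun u => X u ω) / N with hr
  set ρ : (Fin d → Fin s) → ℝ := fun i => ∏ l, p (i l) with hρ
  have hlln : TendstoInMeasure μ r atTop fun _ => ρ := tendstoInMeasure_blockFreq hX hH0 hp d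
  set l : ℂ := ∑ i, (ρ i : ℂ) * v i with hl
  -- `T N` is the logarithm of the product of the conditional characteristic functions.
  set T : ℕ → Ω → ℂ := fun N ω => ∑ i, (r N ω i : ℂ) * (N * Complex.log (φ i N)) with hT
  have hdepT : ∀ N, DependsOn (fun x : ℕ → Fin s => ∑ i, ((windowSum d
      (fun i' _ => if i' = i then (1 : ℝ) else 0) N x / N : ℝ) : ℂ) *
        (N * Complex.log (φ i N))) (Set.Iio (N + d)) := fun N x y h => by
    simp only [dependsOn_windowSum d _ N h]
  have hmeasT : ∀ N, Measurable (T N) := fun N => measurable_of_dependsOn_Iio hX (hdepT N)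
  have hmain : Tendsto (fun N => ∫ ω, ‖1 - Complex.exp (l - T N ω)‖ ∂μ) atTop (𝓝 0) := by
    obtain ⟨M, hM⟩ : ∃ M : ℝ, ∀ N ω, ‖T N ω‖ ≤ M := by
      choose B hB using fun i => (hlog i).norm.bddAbove_range
      refine ⟨∑ i, B i, fun N ω => (norm_sum_le _ _).trans (Finset.sum_le_sum fun i _ => ?_)⟩
      have hi := blockFreq_mem_Icc i N fun u => X u ω
      rw [norm_mul, Complex.norm_real, Real.norm_of_nonneg hi.1]
      exact (mul_le_of_le_one_left (norm_nonneg _) hi.2).trans (hB i ⟨N, rfl⟩)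
    refine tendsto_of_subseq_tendsto fun ns hns => ?_
    obtain ⟨ms, hmono, hms⟩ := TendstoInMeasure.exists_seq_tendsto_ae (hlln.comp hns)
    refine ⟨ms, ?_⟩
    have hsub : Tendsto (fun n => ns (ms n)) atTop atTop := hns.comp hmono.tendsto_atTop
    rw [← integral_zero Ω ℝ (μ := μ)]
    refine tendsto_integral_of_dominated_convergence (fun _ => 1 + Real.exp (‖l‖ + M))
      (fun n => ?_) (integrable_const _) (fun n => ae_of_all _ fun ω => ?_) ?_
    · have := hmeasT (ns (ms n))
      exact Measurable.aestronglyMeasurable (by fun_prop)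
    · rw [norm_norm]
      refine (norm_sub_le _ _).trans ?_
      rw [norm_one]
      gcongr
      refine (Complex.norm_exp_le_exp_norm _).trans (Real.exp_le_exp.2 ?_)
      exact (norm_sub_le _ _).trans (by gcongr; exact hM _ _)
    · filter_upwards [hms] with ω hω
      have hTω : Tendsto (fun n => T (ns (ms n)) ω) atTop (𝓝 l) := by
        refine tendsto_finsetSum _ fun i _ => Tendsto.mul ?_ ((hlog i).comp hsub)
        exact (Complex.continuous_ofReal.tendsto _).comp (tendsto_pi_nhds.1 hω i)
      have hcont : Continuous fun z : ℂ => ‖1 - Complex.exp (l - z)‖ := by fun_prop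
      exact (hcont.tendsto' l 0 (by simp)).comp hTω
  -- As `exp (I * S / √N - T N)` has mean `1`, the difference from the limit is the integral of
  -- `exp (I * S / √N) * (1 - exp (l - T N))`, whose first factor has modulus `1`.
  rw [← tendsto_sub_nhds_zero_iff]
  refine squeeze_zero_norm' ?_ hmain
  filter_upwards [hne, eventually_gt_atTop 0] with N hN hN0
  have hN' : (N : ℂ) ≠ 0 := by exact_mod_cast hN0.ne'
  have hone := integral_exp_windowSum_eq_one hX hH0 hp d
    (g := fun i j => (Complex.I * c i j) * ((√(N : ℝ))⁻¹ : ℝ) - Complex.log (φ i N))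
    (fun i => by
      simp only [Complex.exp_sub, Complex.exp_log (hN i), mul_div_assoc', ← Finset.sum_div]
      exact div_self (hN i)) N
  have hsplit : ∀ ω, windowSum d (fun i j => (Complex.I * c i j) * ((√(N : ℝ))⁻¹ : ℝ) -
      Complex.log (φ i N)) N (fun u => X u ω) = Complex.I *
        ((√(N : ℝ))⁻¹ * windowSum d c N (fun u => X u ω) : ℝ) - T N ω := fun ω => by
    have h1 := windowSum_of_block (fun i => Complex.log (φ i N)) N fun u => X u ω
    have h2 : T N ω = windowSum d (fun i _ => Complex.log (φ i N)) N fun u => X u ω := by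
      rw [h1]
      refine Finset.sum_congr rfl fun i _ => ?_
      simp only [hr]
      push_cast
      field_simp
    rw [h2]
    simp only [windowSum, Finset.sum_sub_distrib]
    push_cast
    simp only [Finset.mul_sum]
    congr 1
    exact Finset.sum_congr rfl fun t _ => by ring
  simp only [hsplit] at hone
  set S : Ω → ℂ := fun ω =>
    Complex.I * ((√(N : ℝ))⁻¹ * windowSum d c N (fun u => X u ω) : ℝ) with hS
  have hdepS : DependsOn (fun x : ℕ → Fin s => Complex.I * ((√(N : ℝ))⁻¹ * windowSum d c N x : ℝ))
      (Set.Iio (N + d)) := fun x y h => by simp only [dependsOn_windowSum d _ N h]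
  have hintS : Integrable (fun ω => Complex.exp (S ω)) μ :=
    integrable_of_dependsOn_Iio hX (Φ := fun x => Complex.exp
      (Complex.I * ((√(N : ℝ))⁻¹ * windowSum d c N x : ℝ))) fun x y h =>
        congrArg Complex.exp (hdepS h)
  have hintST : Integrable (fun ω => Complex.exp (S ω - T N ω)) μ :=
    integrable_of_dependsOn_Iio hX (Φ := fun x => Complex.exp
      (Complex.I * ((√(N : ℝ))⁻¹ * windowSum d c N x : ℝ) - ∑ i, ((windowSum d
      (fun i' _ => if i' = i then (1 : ℝ) else 0) N x / N : ℝ) : ℂ) *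
        (N * Complex.log (φ i N)))) fun x y h =>
        congrArg Complex.exp (congrArg₂ _ (hdepS h) (hdepT N h))
  have hdiff : (∫ ω, Complex.exp (S ω) ∂μ) - Complex.exp l =
      ∫ ω, Complex.exp (S ω) * (1 - Complex.exp (l - T N ω)) ∂μ := by
    calc _ = (∫ ω, Complex.exp (S ω) ∂μ) -
          Complex.exp l * ∫ ω, Complex.exp (S ω - T N ω) ∂μ := by rw [hone, mul_one]
      _ = _ := by
          rw [← integral_const_mul, ← integral_sub hintS (hintST.const_mul _)]
          refine integral_congr_ae (ae_of_all _ fun ω => ?_)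
          simp only
          rw [mul_sub, mul_one, ← Complex.exp_add, ← Complex.exp_add]
          congr 2
          ring
  rw [hdiff]
  refine (norm_integral_le_integral_norm _).trans_eq (integral_congr_ae (ae_of_all _ fun ω => ?_))
  simp only [norm_mul, hS]
  rw [mul_comm Complex.I, Complex.norm_exp_ofReal_mul_I, one_mul]

/-! ### Expansion of the likelihood ratio -/

/-- The function `x ↦ 2 ((1 + x) log (1 + x) - x) / x ^ 2`, extended continuously by `1` at `0`. -/
def entropyQuotient (x : ℝ) : ℝ :=
  if x = 0 then 1 else 2 * ((1 + x) * Real.log (1 + x) - x) / x ^ 2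

lemma sq_mul_entropyQuotient (x : ℝ) :
    x ^ 2 * entropyQuotient x = 2 * ((1 + x) * Real.log (1 + x) - x) := by
  rcases eq_or_ne x 0 with rfl | hx
  · simp
  · rw [entropyQuotient, if_neg hx]
    field_simp

lemma abs_entropyQuotient_sub_one_le {x : ℝ} (hx : |x| ≤ 1 / 2) :
    |entropyQuotient x - 1| ≤ 7 * |x| := by
  rcases eq_or_ne x 0 with rfl | hx0
  · simp [entropyQuotient]
  have hlog := Real.abs_log_sub_add_sum_range_le (x := -x) (by rw [abs_neg]; linarith) 2
  simp only [Finset.sum_range_succ, Finset.sum_range_zero, abs_neg, sub_neg_eq_add] at hlog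
  norm_num at hlog
  set E := -x + x ^ 2 / 2 + Real.log (1 + x) with hE
  have hE2 : |E| ≤ 2 * |x| ^ 3 := by
    refine hlog.trans ?_
    rw [div_le_iff₀ (by linarith)]
    have : 0 ≤ |x| ^ 3 := by positivity
    nlinarith
  have hpos : 0 < x ^ 2 := by positivity
  have hkey : x ^ 2 * (entropyQuotient x - 1) = -x ^ 3 + 2 * (1 + x) * E := by
    rw [mul_sub, sq_mul_entropyQuotient, hE]
    ring
  have h1 : |1 + x| ≤ 3 / 2 := by
    rw [abs_le] at hx ⊢
    constructor <;> linarith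
  have h2 : x ^ 2 * |entropyQuotient x - 1| ≤ x ^ 2 * (7 * |x|) := by
    rw [← abs_of_pos hpos, ← abs_mul, abs_of_pos hpos, hkey]
    calc |-x ^ 3 + 2 * (1 + x) * E| ≤ |-x ^ 3| + |2 * (1 + x) * E| := abs_add_le _ _
      _ = |x| ^ 3 + 2 * |1 + x| * |E| := by
          rw [abs_neg, abs_pow, abs_mul, abs_mul, abs_two]
      _ ≤ |x| ^ 3 + 2 * (3 / 2) * (2 * |x| ^ 3) := by gcongr
      _ = x ^ 2 * (7 * |x|) := by rw [← sq_abs x]; ring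
  exact le_of_mul_le_mul_left h2 hpos

lemma continuous_entropyQuotient : Continuous entropyQuotient := by
  rw [continuous_iff_continuousAt]
  intro x
  rcases eq_or_ne x 0 with rfl | hx
  · rw [ContinuousAt, show entropyQuotient 0 = 1 by simp [entropyQuotient],
      tendsto_iff_norm_sub_tendsto_zero]
    refine squeeze_zero' (Eventually.of_forall fun _ => norm_nonneg _) ?_
      (g := fun x : ℝ => 7 * |x|) ?_
    · filter_upwards [Metric.ball_mem_nhds (0 : ℝ) (by norm_num : (0 : ℝ) < 1 / 2)] with y hy
      rw [Metric.mem_ball, dist_zero_right, Real.norm_eq_abs] at hy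
      exact abs_entropyQuotient_sub_one_le hy.le
    · have : Continuous fun x : ℝ => 7 * |x| := by fun_prop
      exact this.tendsto' 0 0 (by simp)
  · have h : ContinuousAt (fun x : ℝ => 2 * ((1 + x) * Real.log (1 + x) - x) / x ^ 2) x := by
      have hc : Continuous fun x : ℝ => (1 + x) * Real.log (1 + x) :=
        Real.continuous_mul_log.comp (by fun_prop : Continuous fun x : ℝ => 1 + x)
      exact ContinuousAt.div (by fun_prop) (by fun_prop) (pow_ne_zero 2 hx)
    refine h.congr ?_
    filter_upwards [isOpen_ne.mem_nhds hx] with y hy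
    rw [entropyQuotient, if_neg hy]

/-- One cell of the likelihood ratio: observed count `f`, expected count `e`. -/
lemma two_mul_mul_log_div_eq {e f : ℝ} (he : e ≠ 0) :
    2 * (f * Real.log (f / e)) = 2 * (f - e) +
      (f - e) ^ 2 / e * entropyQuotient ((f - e) / e) := by
  have h := sq_mul_entropyQuotient ((f - e) / e)
  have h1 : 1 + (f - e) / e = f / e := by field_simp; ring
  rw [h1] at h
  have h2 : (f - e) ^ 2 / e = e * ((f - e) / e) ^ 2 := by field_simp
  rw [h2, mul_assoc, h]
  field_simp
  ring

/-- The likelihood ratio statistic of a table `F` is the likelihood ratio for known column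
probabilities `p` minus the one of the column sums. -/
lemma likelihoodRatio_eq {I J : Type*} [Fintype I] [Fintype J] {F : I → J → ℝ} {p : J → ℝ}
    {N : ℝ} (hF : ∀ i j, 0 ≤ F i j) (hp : ∀ j, 0 < p j) (hp1 : ∑ j, p j = 1) (hN : 0 < N)
    (hFN : ∑ i, ∑ j, F i j = N) (hR : ∀ i, 0 < ∑ j, F i j) :
    2 * ∑ i, ∑ j, F i j * Real.log (N * F i j / ((∑ i, F i j) * ∑ j, F i j)) =
      (∑ i, ∑ j, (F i j - (∑ j, F i j) * p j) ^ 2 / ((∑ j, F i j) * p j) *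
        entropyQuotient ((F i j - (∑ j, F i j) * p j) / ((∑ j, F i j) * p j))) -
      ∑ j, ((∑ i, F i j) - N * p j) ^ 2 / (N * p j) *
        entropyQuotient (((∑ i, F i j) - N * p j) / (N * p j)) := by
  set R : I → ℝ := fun i => ∑ j, F i j with hRdef
  set C : J → ℝ := fun j => ∑ i, F i j with hCdef
  have hCN : ∑ j, C j = N := by rw [← hFN, Finset.sum_comm]
  have hterm : ∀ i j, F i j * Real.log (N * F i j / (C j * R i)) =
      F i j * Real.log (F i j / (R i * p j)) - F i j * Real.log (C j / (N * p j)) := by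
    intro i j
    rcases (hF i j).eq_or_lt with h | h
    · simp [← h]
    have hC : 0 < C j :=
      h.trans_le (Finset.single_le_sum (f := fun i => F i j) (fun i _ => hF i j)
        (Finset.mem_univ i))
    have := hR i
    have hRi : 0 < R i := hR i
    have := hp j
    rw [← mul_sub, ← Real.log_div (by positivity) (by positivity)]
    congr 2
    field_simp
  have h1 : ∑ i, ∑ j, F i j * Real.log (C j / (N * p j)) =
      ∑ j, C j * Real.log (C j / (N * p j)) := by
    rw [Finset.sum_comm]
    simp only [hCdef, Finset.sum_mul]
  have h2 : ∑ i, ∑ j, 2 * (F i j - R i * p j) = 0 := by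
    refine Finset.sum_eq_zero fun i _ => ?_
    rw [← Finset.mul_sum, Finset.sum_sub_distrib, ← Finset.mul_sum, hp1]
    simp [hRdef]
  have h3 : ∑ j, 2 * (C j - N * p j) = 0 := by
    rw [← Finset.mul_sum, Finset.sum_sub_distrib, ← Finset.mul_sum, hp1, hCN]
    simp
  calc 2 * ∑ i, ∑ j, F i j * Real.log (N * F i j / (C j * R i))
      = (∑ i, ∑ j, 2 * (F i j * Real.log (F i j / (R i * p j)))) -
        ∑ j, 2 * (C j * Real.log (C j / (N * p j))) := by
        simp only [hterm, Finset.sum_sub_distrib, h1, mul_sub, Finset.mul_sum]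
    _ = _ := by
        have he : ∀ i j, 2 * (F i j * Real.log (F i j / (R i * p j))) = 2 * (F i j - R i * p j) +
            (F i j - R i * p j) ^ 2 / (R i * p j) *
              entropyQuotient ((F i j - R i * p j) / (R i * p j)) := fun i j =>
          two_mul_mul_log_div_eq (mul_pos (hR i) (hp j)).ne'
        have he' : ∀ j, 2 * (C j * Real.log (C j / (N * p j))) = 2 * (C j - N * p j) +
            (C j - N * p j) ^ 2 / (N * p j) *
              entropyQuotient ((C j - N * p j) / (N * p j)) := fun j =>
          two_mul_mul_log_div_eq (mul_pos hN (hp j)).ne'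
        simp only [he, he', Finset.sum_add_distrib, h2, h3, zero_add]
        rfl

/-- The likelihood ratio statistic as a function of the normalised deviations
`y i j = (F i j - R i * p j) / √N`, of the row frequencies `r i = R i / N` and of `ε = 1 / √N`.
The row frequencies are truncated below at half their limits `q i`, which makes the function
continuous everywhere. -/
def likelihoodRatioExpansion {I J : Type*} [Fintype I] [Fintype J] (q : I → ℝ) (p : J → ℝ)
    (y : I → J → ℝ) (r : I → ℝ) (ε : ℝ) : ℝ :=
  (∑ i, ∑ j, y i j ^ 2 / (max (r i) (q i / 2) * p j) *
    entropyQuotient (ε * y i j / (max (r i) (q i / 2) * p j))) -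
  ∑ j, (∑ i, y i j) ^ 2 / p j * entropyQuotient (ε * (∑ i, y i j) / p j)

lemma likelihoodRatio_eq_expansion {I J : Type*} [Fintype I] [Fintype J] {F : I → J → ℝ}
    {q : I → ℝ} {p : J → ℝ} {N : ℝ} (hF : ∀ i j, 0 ≤ F i j) (hq : ∀ i, 0 < q i)
    (hp : ∀ j, 0 < p j) (hp1 : ∑ j, p j = 1) (hN : 0 < N) (hFN : ∑ i, ∑ j, F i j = N)
    (hr : ∀ i, q i / 2 ≤ (∑ j, F i j) / N) :
    2 * ∑ i, ∑ j, F i j * Real.log (N * F i j / ((∑ i, F i j) * ∑ j, F i j)) =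
      likelihoodRatioExpansion q p (fun i j => (√N)⁻¹ * (F i j - (∑ j, F i j) * p j))
        (fun i => (∑ j, F i j) / N) (√N)⁻¹ := by
  have hR : ∀ i, 0 < ∑ j, F i j := fun i => by
    have h := (half_pos (hq i)).trans_le (hr i)
    rwa [lt_div_iff₀ hN, zero_mul] at h
  rw [likelihoodRatio_eq hF hp hp1 hN hFN hR, likelihoodRatioExpansion]
  obtain ⟨e, he, rfl⟩ : ∃ e : ℝ, 0 < e ∧ N = e ^ 2 :=
    ⟨√N, Real.sqrt_pos.2 hN, (Real.sq_sqrt hN.le).symm⟩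
  rw [Real.sqrt_sq he.le]
  congr 1
  · refine Finset.sum_congr rfl fun i _ => Finset.sum_congr rfl fun j _ => ?_
    rw [max_eq_left (hr i)]
    have := (hR i).ne'
    have := (hp j).ne'
    congr 1
    · field_simp
    · congr 1
      field_simp
  · refine Finset.sum_congr rfl fun j _ => ?_
    have := (hp j).ne'
    have hsum : ∑ i, e⁻¹ * (F i j - (∑ j, F i j) * p j) = e⁻¹ * ((∑ i, F i j) - e ^ 2 * p j) := by
      rw [← Finset.mul_sum, Finset.sum_sub_distrib, ← Finset.sum_mul, hFN]
    rw [hsum]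
    congr 1
    · field_simp
    · congr 1
      field_simp

lemma likelihoodRatioExpansion_zero {I J : Type*} [Fintype I] [Fintype J] {q : I → ℝ}
    (hq : ∀ i, 0 < q i) (p : J → ℝ) (y : I → J → ℝ) :
    likelihoodRatioExpansion q p y q 0 =
      (∑ i, ∑ j, y i j ^ 2 / (q i * p j)) - ∑ j, (∑ i, y i j) ^ 2 / p j := by
  have h : ∀ i, max (q i) (q i / 2) = q i := fun i => max_eq_left (by linarith [hq i])
  simp [likelihoodRatioExpansion, h, entropyQuotient]

lemma continuous_likelihoodRatioExpansion {I J T : Type*} [Fintype I] [Fintype J]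
    [TopologicalSpace T] {q : I → ℝ} {p : J → ℝ} (hq : ∀ i, 0 < q i) (hp : ∀ j, 0 < p j)
    {y : T → I → J → ℝ} {r : T → I → ℝ} {ε : T → ℝ} (hy : ∀ i j, Continuous fun t => y t i j)
    (hr : ∀ i, Continuous fun t => r t i) (hε : Continuous ε) :
    Continuous fun t => likelihoodRatioExpansion q p (y t) (r t) (ε t) := by
  have hpos : ∀ t i j, max (r t i) (q i / 2) * p j ≠ 0 := fun t i j =>
    (mul_pos (lt_max_of_lt_right (half_pos (hq i))) (hp j)).ne'
  have hsum : ∀ j, Continuous fun t => ∑ i, y t i j := fun j =>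
    continuous_finsetSum _ fun i _ => hy i j
  unfold likelihoodRatioExpansion
  refine Continuous.sub (continuous_finsetSum _ fun i _ => continuous_finsetSum _ fun j _ => ?_)
    (continuous_finsetSum _ fun j _ => ?_)
  · have hd : Continuous fun t => max (r t i) (q i / 2) * p j :=
      ((hr i).max continuous_const).mul continuous_const
    exact (((hy i j).pow 2).div hd fun t => hpos t i j).mul
      (continuous_entropyQuotient.comp ((hε.mul (hy i j)).div hd fun t => hpos t i j))
  · exact (((hsum j).pow 2).div_const _).mul
      (continuous_entropyQuotient.comp ((hε.mul (hsum j)).div_const _))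

/-! ### Orthonormal coordinates on tables -/

/-- A unit vector is the first row of a square matrix with orthonormal rows and columns. -/
lemma exists_orthonormal_rows {ι : Type*} [Fintype ι] [DecidableEq ι] {n : ℕ}
    (hcard : Fintype.card ι = n + 1) {u : ι → ℝ} (hu : ∑ i, u i ^ 2 = 1) :
    ∃ a : Fin (n + 1) → ι → ℝ, a 0 = u ∧
      (∀ k l, ∑ i, a k i * a l i = if k = l then 1 else 0) ∧
      ∀ i j, ∑ k, a k i * a k j = if i = j then 1 else 0 := by
  have hnorm : ‖WithLp.toLp 2 u‖ = 1 := by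
    rw [← sq_eq_sq₀ (norm_nonneg _) zero_le_one, EuclideanSpace.real_norm_sq_eq, one_pow]
    exact hu
  obtain ⟨b, hb⟩ := Orthonormal.exists_orthonormalBasis_extension_of_card_eq (𝕜 := ℝ)
    (E := EuclideanSpace ℝ ι) (ι := Fin (n + 1)) (by simp [hcard])
    (v := fun _ => WithLp.toLp 2 u) (s := {0})
    ⟨fun _ => hnorm, fun i j hij => (hij (Subsingleton.elim i j)).elim⟩
  refine ⟨fun k i => b k i, ?_, fun k l => ?_, fun i j => ?_⟩
  · funext i
    simp [hb 0 rfl]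
  · have h := orthonormal_iff_ite.1 b.orthonormal k l
    rw [PiLp.inner_apply] at h
    simpa [mul_comm] using h
  · have h := b.sum_inner_mul_inner (EuclideanSpace.single i 1) (EuclideanSpace.single j 1)
    simpa [EuclideanSpace.inner_single_left, EuclideanSpace.inner_single_right, eq_comm] using h

/-- Parseval's identity for a family with orthonormal rows. -/
lemma sum_sq_sum_mul_eq {ι κ : Type*} [Fintype ι] [Fintype κ] [DecidableEq κ] {a : κ → ι → ℝ}
    (ha : ∀ k l, ∑ i, a k i * a l i = if k = l then 1 else 0) (w : κ → ℝ) :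
    ∑ i, (∑ k, w k * a k i) ^ 2 = ∑ k, w k ^ 2 := by
  calc ∑ i, (∑ k, w k * a k i) ^ 2 = ∑ i, ∑ k, ∑ l, w k * w l * (a k i * a l i) := by
        refine Finset.sum_congr rfl fun i _ => ?_
        rw [sq, Finset.sum_mul_sum]
        exact Finset.sum_congr rfl fun k _ => Finset.sum_congr rfl fun l _ => by ring
    _ = ∑ k, ∑ l, w k * w l * ∑ i, a k i * a l i := by
        rw [Finset.sum_comm]
        refine Finset.sum_congr rfl fun k _ => ?_
        rw [Finset.sum_comm]
        exact Finset.sum_congr rfl fun l _ => (Finset.mul_sum _ _ _).symm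
    _ = ∑ k, w k ^ 2 := by
        simp [ha, sq]

/-- The table with coordinates `w` in the products of the vectors `a k` and `b l`. -/
def tableOfCoords {I J K L : Type*} [Fintype K] [Fintype L] (a : K → I → ℝ) (b : L → J → ℝ)
    (w : K → L → ℝ) (i : I) (j : J) : ℝ :=
  ∑ k, (∑ l, w k l * b l j) * a k i

lemma sum_sq_tableOfCoords {I J K L : Type*} [Fintype I] [Fintype J] [Fintype K] [Fintype L]
    [DecidableEq K] [DecidableEq L] {a : K → I → ℝ} {b : L → J → ℝ}
    (ha : ∀ k l, ∑ i, a k i * a l i = if k = l then 1 else 0)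
    (hb : ∀ k l, ∑ j, b k j * b l j = if k = l then 1 else 0) (w : K → L → ℝ) :
    ∑ i, ∑ j, tableOfCoords a b w i j ^ 2 = ∑ k, ∑ l, w k l ^ 2 := by
  rw [Finset.sum_comm]
  simp only [tableOfCoords, sum_sq_sum_mul_eq ha]
  rw [Finset.sum_comm]
  simp only [sum_sq_sum_mul_eq hb]

lemma sum_mul_tableOfCoords_right {I J K L : Type*} [Fintype J] [Fintype K] [Fintype L]
    (a : K → I → ℝ) {b : L → J → ℝ} {v : J → ℝ} (hv : ∀ l, ∑ j, v j * b l j = 0)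
    (w : K → L → ℝ) (i : I) : ∑ j, v j * tableOfCoords a b w i j = 0 := by
  calc ∑ j, v j * tableOfCoords a b w i j
      = ∑ k, ∑ l, w k l * a k i * ∑ j, v j * b l j := by
        simp only [tableOfCoords, Finset.mul_sum, Finset.sum_mul]
        rw [Finset.sum_comm]
        refine Finset.sum_congr rfl fun k _ => ?_
        rw [Finset.sum_comm]
        exact Finset.sum_congr rfl fun l _ => Finset.sum_congr rfl fun j _ => by ring
    _ = 0 := by simp [hv]

/-- Removing the component along the first row vector removes the coordinates with index `0`. -/
lemma sum_sq_sub_sum_sq_tableOfCoords {I J L : Type*} [Fintype I] [Fintype J] [Fintype L]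
    [DecidableEq L] {n : ℕ} {a : Fin (n + 1) → I → ℝ} {b : L → J → ℝ}
    (ha : ∀ k l, ∑ i, a k i * a l i = if k = l then 1 else 0)
    (hb : ∀ k l, ∑ j, b k j * b l j = if k = l then 1 else 0) (w : Fin (n + 1) → L → ℝ) :
    (∑ i, ∑ j, tableOfCoords a b w i j ^ 2) - ∑ j, (∑ i, a 0 i * tableOfCoords a b w i j) ^ 2 =
      ∑ k : Fin n, ∑ l, w k.succ l ^ 2 := by
  have h : ∀ j, ∑ i, a 0 i * tableOfCoords a b w i j = ∑ l, w 0 l * b l j := fun j => by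
    calc ∑ i, a 0 i * tableOfCoords a b w i j
        = ∑ k, (∑ l, w k l * b l j) * ∑ i, a 0 i * a k i := by
          simp only [tableOfCoords]
          simp only [Finset.mul_sum]
          rw [Finset.sum_comm]
          exact Finset.sum_congr rfl fun k _ => Finset.sum_congr rfl fun i _ => by ring
      _ = _ := by simp [ha]
  simp only [h, sum_sq_sum_mul_eq hb, sum_sq_tableOfCoords ha hb, Fin.sum_univ_succ (n := n)]
  ring

/-- A table orthogonal to `b 0` in each row is recovered from its other coordinates. -/
lemma tableOfCoords_eq {I J K : Type*} [Fintype I] [Fintype J] [Fintype K] [DecidableEq I]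
    [DecidableEq J] {n : ℕ} {a : K → I → ℝ} {b : Fin (n + 1) → J → ℝ}
    (ha : ∀ i j, ∑ k, a k i * a k j = if i = j then 1 else 0)
    (hb : ∀ i j, ∑ l, b l i * b l j = if i = j then 1 else 0) {z : I → J → ℝ}
    (hz : ∀ i, ∑ j, z i j * b 0 j = 0) (i : I) (j : J) :
    tableOfCoords a (fun l : Fin n => b l.succ)
      (fun k l => ∑ i, ∑ j, z i j * (a k i * b l.succ j)) i j = z i j := by
  have h1 : ∀ k, ∑ l : Fin n, (∑ i, ∑ j, z i j * (a k i * b l.succ j)) * b l.succ j =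
      ∑ i, z i j * a k i := fun k => by
    have h0 : ∑ i, ∑ j', z i j' * (a k i * b 0 j') = 0 :=
      Finset.sum_eq_zero fun i _ => by
        calc _ = a k i * ∑ j', z i j' * b 0 j' := by
              rw [Finset.mul_sum]; exact Finset.sum_congr rfl fun _ _ => by ring
          _ = 0 := by rw [hz, mul_zero]
    calc _ = ∑ l : Fin (n + 1), (∑ i, ∑ j', z i j' * (a k i * b l j')) * b l j := by
          rw [Fin.sum_univ_succ, h0]; simp
      _ = ∑ i, ∑ j', z i j' * a k i * ∑ l, b l j' * b l j := by
          simp only [Finset.sum_mul, Finset.mul_sum]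
          rw [Finset.sum_comm]
          refine Finset.sum_congr rfl fun i _ => ?_
          rw [Finset.sum_comm]
          exact Finset.sum_congr rfl fun j' _ => Finset.sum_congr rfl fun l _ => by ring
      _ = _ := by simp [hb]
  simp only [tableOfCoords, h1]
  simp only [Finset.sum_mul]
  rw [Finset.sum_comm]
  simp only [mul_assoc, ← Finset.mul_sum, ha]
  simp

/-! ### The limiting distribution -/

/-- The squared length of a coordinate projection of a standard Gaussian vector is `χ²`
distributed. -/
lemma map_stdGaussian_sum_sq_eq_chiSquared (m r : ℕ) :
    (stdGaussian (EuclideanSpace ℝ (Fin (m + 1) × Fin r))).map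
      (fun z => ∑ k : Fin m, ∑ l : Fin r, z (k.succ, l) ^ 2) = chiSquared (m * r) := by
  set γ : Measure (Fin (m + 1) × Fin r → ℝ) := Measure.pi fun _ => gaussianReal 0 1 with hγ
  set e : Fin (m * r) → Fin (m + 1) × Fin r := fun x =>
    ((finProdFinEquiv.symm x).1.succ, (finProdFinEquiv.symm x).2) with he
  have hinj : Function.Injective e := fun x y hxy => by
    simp only [he, Prod.mk.injEq, Fin.succ_inj] at hxy
    exact finProdFinEquiv.symm.injective (Prod.ext hxy.1 hxy.2)
  have hind : iIndepFun (fun (x : Fin (m * r)) (z : Fin (m + 1) × Fin r → ℝ) => z (e x)) γ :=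
    (iIndepFun_pi (X := fun _ (x : ℝ) => x) fun _ => by fun_prop).precomp hinj
  have hmap : γ.map (fun z x => z (e x)) = Measure.pi fun _ => gaussianReal 0 1 := by
    rw [(iIndepFun_iff_map_fun_eq_pi_map fun x =>
      (measurable_pi_apply (e x)).aemeasurable).1 hind]
    congr 1
    funext x
    exact (measurePreserving_eval (fun _ => gaussianReal 0 1) (e x)).map_eq
  rw [chiSquared, ← hmap, ← map_pi_eq_stdGaussian, Measure.map_map (by fun_prop) (by fun_prop),
    Measure.map_map (by fun_prop) (by fun_prop)]
  congr 1
  funext z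
  simp only [Function.comp, he]
  rw [← finProdFinEquiv.sum_comp, Fintype.sum_prod_type]
  simp

/-! ### Tables of counts -/

/-- The number of the first `N` windows of the word `x` in which the block `i` of length `d` is
followed by the symbol `j`, as a real number. -/
def windowCount (d N : ℕ) (x : ℕ → Fin s) (i : Fin d → Fin s) (j : Fin s) : ℝ :=
  windowSum d (fun i' j' => if i' = i ∧ j' = j then 1 else 0) N x

lemma windowCount_nonneg (d N : ℕ) (x : ℕ → Fin s) (i : Fin d → Fin s) (j : Fin s) :
    0 ≤ windowCount d N x i j := by
  simp only [windowCount, windowSum]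
  exact Finset.sum_nonneg fun t _ => by split_ifs <;> norm_num

lemma cast_blockCount (k n : ℕ) (x : ℕ → Fin s) (i : Fin (k - 1) → Fin s) (j : Fin s) :
    (blockCount k n x i j : ℝ) = windowCount (k - 1) (n + 1 - k) x i j := by
  simp [blockCount, windowCount, windowSum, funext_iff]

lemma windowSum_eq_sum_windowCount_mul {d : ℕ} (g : (Fin d → Fin s) → Fin s → ℝ) (N : ℕ)
    (x : ℕ → Fin s) : windowSum d g N x = ∑ i, ∑ j, windowCount d N x i j * g i j := by
  simp only [windowCount, windowSum, Finset.sum_mul]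
  rw [Finset.sum_congr rfl fun i _ => Finset.sum_comm, Finset.sum_comm]
  refine Finset.sum_congr rfl fun t _ => ?_
  simp [ite_and]

lemma sum_windowCount_right (d N : ℕ) (x : ℕ → Fin s) (i : Fin d → Fin s) :
    ∑ j, windowCount d N x i j = windowSum d (fun i' _ => if i' = i then 1 else 0) N x := by
  rw [windowSum_eq_sum_windowCount_mul]
  simp

lemma sum_windowCount (d N : ℕ) (x : ℕ → Fin s) : ∑ i, ∑ j, windowCount d N x i j = N := by
  have h := windowSum_eq_sum_windowCount_mul (d := d) (fun _ _ => (1 : ℝ)) N x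
  simp only [mul_one] at h
  rw [← h]
  simp [windowSum]

/-- The likelihood ratio statistic of the first `N` windows of length `d + 1` of a word. -/
def likelihoodRatio (d N : ℕ) (x : ℕ → Fin s) : ℝ :=
  2 * ∑ i, ∑ j, windowCount d N x i j * Real.log (N * windowCount d N x i j /
    ((∑ i, windowCount d N x i j) * ∑ j, windowCount d N x i j))

lemma dependsOn_likelihoodRatio (d N : ℕ) :
    DependsOn (likelihoodRatio (s := s) d N) (Set.Iio (N + d)) := by
  have h : DependsOn (windowCount (s := s) d N) (Set.Iio (N + d)) := fun x y h => by
    funext i j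
    exact dependsOn_windowSum d _ N h
  intro x y hxy
  simp only [likelihoodRatio, h hxy]

lemma npStatistic_eq_likelihoodRatio {k n : ℕ} (hkn : k ≤ n) (x : ℕ → Fin s) :
    npStatistic k n x = likelihoodRatio (k - 1) (n + 1 - k) x := by
  have h : ((n + 1 - k : ℕ) : ℝ) = (n : ℝ) - k + 1 := by
    rw [Nat.cast_sub (by omega)]
    push_cast
    ring
  simp only [npStatistic, likelihoodRatio, colCount, rowCount, Nat.cast_sum, cast_blockCount, h]

/-! ### Convergence of the normalised table -/

/-- The coordinates with respect to the products `a k i * b l j` of the normalised table of counts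
`F i j / √(N * q i * p j)` of the first `N` windows. -/
def countCoords {d : ℕ} {K L : Type*} (q : (Fin d → Fin s) → ℝ) (p : Fin s → ℝ)
    (a : K → (Fin d → Fin s) → ℝ) (b : L → Fin s → ℝ) (N : ℕ) (x : ℕ → Fin s) :
    EuclideanSpace ℝ (K × L) :=
  WithLp.toLp 2 fun kl => (√(N : ℝ))⁻¹ *
    windowSum d (fun i j => (√(q i))⁻¹ * (√(p j))⁻¹ * (a kl.1 i * b kl.2 j)) N x

lemma dependsOn_countCoords {d : ℕ} {K L : Type*} (q : (Fin d → Fin s) → ℝ) (p : Fin s → ℝ)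
    (a : K → (Fin d → Fin s) → ℝ) (b : L → Fin s → ℝ) (N : ℕ) :
    DependsOn (countCoords q p a b N) (Set.Iio (N + d)) := fun x y h => by
  simp only [countCoords, dependsOn_windowSum d _ N h]

/-- If the `a k` are orthonormal and the `b l` are orthonormal and orthogonal to `√p`, then the
coordinates of the table of counts are asymptotically independent standard normal variables. -/
theorem tendstoInDistribution_countCoords [IsProbabilityMeasure μ] (hX : ∀ t, Measurable (X t))
    (hH0 : IsUnpredictable X μ) {p : Fin s → ℝ} (hp : ∀ t a, μ.real {ω | X t ω = a} = p a)
    (hp0 : ∀ a, 0 < p a) {d : ℕ} {K L : Type*} [Fintype K] [Fintype L] [DecidableEq K]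
    [DecidableEq L] {a : K → (Fin d → Fin s) → ℝ} {b : L → Fin s → ℝ}
    (ha : ∀ k l, ∑ i, a k i * a l i = if k = l then 1 else 0)
    (hb : ∀ k l, ∑ j, b k j * b l j = if k = l then 1 else 0)
    (hbp : ∀ l, ∑ j, √(p j) * b l j = 0) :
    TendstoInDistribution (fun (N : ℕ) ω => countCoords (fun i => ∏ l, p (i l)) p a b N
      fun u => X u ω) atTop id (fun _ => μ) (stdGaussian (EuclideanSpace ℝ (K × L))) := by
  set q : (Fin d → Fin s) → ℝ := fun i => ∏ l, p (i l) with hq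
  have hq0 : ∀ i, 0 < q i := fun i => Finset.prod_pos fun l _ => hp0 _
  have hmeas : ∀ N, Measurable fun ω => countCoords q p a b N fun u => X u ω := fun N =>
    measurable_of_dependsOn_Iio hX (dependsOn_countCoords q p a b N)
  refine ⟨fun N => (hmeas N).aemeasurable, aemeasurable_id, ?_⟩
  refine ProbabilityMeasure.tendsto_iff_tendsto_charFun.2 fun w => ?_
  change Tendsto (fun N => charFun (μ.map fun ω => countCoords q p a b N fun u => X u ω) w) atTop
    (𝓝 (charFun ((stdGaussian (EuclideanSpace ℝ (K × L))).map id) w))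
  rw [Measure.map_id, charFun_stdGaussian]
  -- The projection on `w` is the window sum of the table with coordinates `w`.
  set z : (Fin d → Fin s) → Fin s → ℝ := tableOfCoords a b fun k l => w (k, l) with hz
  have hcentred : ∀ i, ∑ j, p j * ((√(q i))⁻¹ * (√(p j))⁻¹ * z i j) = 0 := fun i => by
    calc _ = (√(q i))⁻¹ * ∑ j, √(p j) * z i j := by
          rw [Finset.mul_sum]
          refine Finset.sum_congr rfl fun j _ => ?_
          have := Real.sqrt_pos.2 (hp0 j)
          nth_rewrite 1 [← Real.mul_self_sqrt (hp0 j).le]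
          field_simp
      _ = 0 := by rw [sum_mul_tableOfCoords_right a hbp, mul_zero]
  have hclt := tendsto_integral_exp_windowSum hX hH0 hp d hcentred
  have hvar : ∑ i, ((q i : ℝ) : ℂ) *
      (-(∑ j, p j * ((√(q i))⁻¹ * (√(p j))⁻¹ * z i j) ^ 2 : ℝ) / 2 : ℂ) = -(‖w‖ : ℂ) ^ 2 / 2 := by
    have h : ∑ i, q i * ∑ j, p j * ((√(q i))⁻¹ * (√(p j))⁻¹ * z i j) ^ 2 = ‖w‖ ^ 2 := by
      rw [EuclideanSpace.real_norm_sq_eq, Fintype.sum_prod_type, ← sum_sq_tableOfCoords ha hb]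
      refine Finset.sum_congr rfl fun i _ => ?_
      rw [Finset.mul_sum]
      refine Finset.sum_congr rfl fun j _ => ?_
      rw [mul_pow, mul_pow, inv_pow, inv_pow, Real.sq_sqrt (hq0 i).le, Real.sq_sqrt (hp0 j).le]
      have := (hq0 i).ne'
      have := (hp0 j).ne'
      field_simp
      rfl
    rw [← Complex.ofReal_pow, ← h, Complex.ofReal_sum, neg_div, Finset.sum_div,
      ← Finset.sum_neg_distrib]
    refine Finset.sum_congr rfl fun i _ => ?_
    rw [Complex.ofReal_mul]
    ring
  rw [hvar] at hclt
  refine hclt.congr fun N => ?_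
  rw [charFun_apply, integral_map (hmeas N).aemeasurable
    (Measurable.aestronglyMeasurable (by fun_prop))]
  refine integral_congr_ae (ae_of_all _ fun ω => ?_)
  simp only
  rw [mul_comm Complex.I]
  congr 3
  rw [PiLp.inner_apply, Fintype.sum_prod_type]
  simp only [countCoords, RCLike.inner_apply, conj_trivial, hz, tableOfCoords, windowSum,
    Finset.mul_sum, Finset.sum_mul]
  symm
  rw [Finset.sum_congr rfl fun k _ => Finset.sum_comm, Finset.sum_comm]
  refine Finset.sum_congr rfl fun t _ => Finset.sum_congr rfl fun k _ =>
    Finset.sum_congr rfl fun l _ => ?_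
  ring

/-- The normalised deviations of the counts from their conditional expectations are recovered from
the coordinates of the table. -/
lemma mul_tableOfCoords_countCoords {d n : ℕ} {K : Type*} [Fintype K]
    {q : (Fin d → Fin s) → ℝ} {p : Fin s → ℝ} (hq0 : ∀ i, 0 < q i) (hp0 : ∀ j, 0 < p j)
    (hp1 : ∑ j, p j = 1) {a : K → (Fin d → Fin s) → ℝ} {b : Fin (n + 1) → Fin s → ℝ}
    (ha : ∀ i j, ∑ k, a k i * a k j = if i = j then 1 else 0)
    (hb : ∀ i j, ∑ l, b l i * b l j = if i = j then 1 else 0) (hb0 : ∀ j, b 0 j = √(p j))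
    (hbp : ∀ l : Fin n, ∑ j, √(p j) * b l.succ j = 0) (N : ℕ) (x : ℕ → Fin s)
    (i : Fin d → Fin s) (j : Fin s) :
    √(q i) * √(p j) * tableOfCoords a (fun l : Fin n => b l.succ)
      (fun k l => countCoords q p a (fun l : Fin n => b l.succ) N x (k, l)) i j =
      (√(N : ℝ))⁻¹ * (windowCount d N x i j - (∑ j, windowCount d N x i j) * p j) := by
  have hsq : ∀ i, 0 < √(q i) := fun i => Real.sqrt_pos.2 (hq0 i)
  have hsp : ∀ j, 0 < √(p j) := fun j => Real.sqrt_pos.2 (hp0 j)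
  set F := windowCount d N x with hF
  set z : (Fin d → Fin s) → Fin s → ℝ := fun i j =>
    (√(N : ℝ))⁻¹ * (F i j - (∑ j, F i j) * p j) * ((√(q i))⁻¹ * (√(p j))⁻¹) with hz
  have hpp : ∀ j, p j * (√(p j))⁻¹ = √(p j) := fun j => by
    have := hsp j
    nth_rewrite 1 [← Real.mul_self_sqrt (hp0 j).le]
    field_simp
  have hz0 : ∀ i, ∑ j, z i j * b 0 j = 0 := fun i => by
    calc _ = (√(N : ℝ))⁻¹ * (√(q i))⁻¹ * ((∑ j, F i j) - (∑ j, F i j) * ∑ j, p j) := by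
          rw [Finset.mul_sum, ← Finset.sum_sub_distrib, Finset.mul_sum]
          refine Finset.sum_congr rfl fun j _ => ?_
          have := hsp j
          simp only [hz, hb0]
          field_simp
      _ = 0 := by rw [hp1]; ring
  have hcoord : ∀ (k : K) (l : Fin n), countCoords q p a (fun l : Fin n => b l.succ) N x (k, l) =
      ∑ i, ∑ j, z i j * (a k i * b l.succ j) := fun k l => by
    have h0 : ∀ i, ∑ j, (√(N : ℝ))⁻¹ * ((∑ j, F i j) * p j) * ((√(q i))⁻¹ * (√(p j))⁻¹) *
        (a k i * b l.succ j) = 0 := fun i => by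
      calc _ = (√(N : ℝ))⁻¹ * (∑ j, F i j) * (√(q i))⁻¹ * a k i * ∑ j, √(p j) * b l.succ j := by
            rw [Finset.mul_sum]
            refine Finset.sum_congr rfl fun j _ => ?_
            linear_combination
              (√(N : ℝ))⁻¹ * (∑ j, F i j) * (√(q i))⁻¹ * a k i * b l.succ j * hpp j
        _ = 0 := by rw [hbp, mul_zero]
    simp only [countCoords, hz]
    rw [windowSum_eq_sum_windowCount_mul, Finset.mul_sum]
    refine Finset.sum_congr rfl fun i _ => ?_
    rw [← sub_zero (_ * _), ← h0 i, Finset.mul_sum, ← Finset.sum_sub_distrib]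
    exact Finset.sum_congr rfl fun j _ => by ring
  simp only [hcoord, tableOfCoords_eq ha hb hz0]
  have := hsq i
  have := hsp j
  simp only [hz]
  field_simp

/-! ### The asymptotic distribution -/

/-- The likelihood ratio statistic of the first `N` windows is asymptotically `χ²` distributed. -/
theorem tendstoInDistribution_likelihoodRatio [IsProbabilityMeasure μ]
    (hX : ∀ t, Measurable (X t)) (hH0 : IsUnpredictable X μ) {p : Fin s → ℝ}
    (hp : ∀ t a, μ.real {ω | X t ω = a} = p a) (hp0 : ∀ a, 0 < p a) (d : ℕ) :
    TendstoInDistribution (fun (N : ℕ) ω => likelihoodRatio d N fun u => X u ω) atTop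
      (id : ℝ → ℝ) (fun _ => μ) (chiSquared ((s ^ d - 1) * (s - 1))) := by
  have hNe : Nonempty Ω := μ.nonempty_of_neZero
  have hs : 0 < s := Fin.pos (X 0 (Classical.arbitrary Ω))
  obtain ⟨n, hn⟩ : ∃ n, s = n + 1 := ⟨s - 1, by omega⟩
  obtain ⟨m, hm⟩ : ∃ m, s ^ d = m + 1 := ⟨s ^ d - 1, by have := pow_pos hs d; omega⟩
  rw [hm, Nat.add_sub_cancel, show s - 1 = n by omega]
  have hp1 : ∑ j, p j = 1 := sum_measureReal_eq_one hX hp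
  set q : (Fin d → Fin s) → ℝ := fun i => ∏ l, p (i l) with hq
  have hq0 : ∀ i, 0 < q i := fun i => Finset.prod_pos fun l _ => hp0 _
  have hq1 : ∑ i, q i = 1 := by
    have h := Fintype.sum_pow p d
    rw [hp1, one_pow] at h
    exact h.symm
  obtain ⟨a, ha0, ha, ha'⟩ := exists_orthonormal_rows (n := m) (u := fun i => √(q i))
    (by simpa using hm) (by simpa only [Real.sq_sqrt (hq0 _).le] using hq1)
  obtain ⟨b, hb0, hb, hb'⟩ := exists_orthonormal_rows (n := n) (u := fun j => √(p j))
    (by simpa using hn) (by simpa only [Real.sq_sqrt (hp0 _).le] using hp1)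
  have hbs : ∀ k l : Fin n, ∑ j, b k.succ j * b l.succ j = if k = l then 1 else 0 := fun k l => by
    simpa using hb k.succ l.succ
  have hbp : ∀ l : Fin n, ∑ j, √(p j) * b l.succ j = 0 := fun l => by
    have h := hb 0 l.succ
    rw [hb0] at h
    simpa [(Fin.succ_ne_zero l).symm] using h
  set W : ℕ → Ω → EuclideanSpace ℝ (Fin (m + 1) × Fin n) := fun N ω =>
    countCoords q p a (fun l : Fin n => b l.succ) N fun u => X u ω with hW
  set r : ℕ → Ω → (Fin d → Fin s) → ℝ := fun N ω i =>
    windowSum d (fun i' _ => if i' = i then (1 : ℝ) else 0) N (fun u => X u ω) / N with hr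
  have hWlim : TendstoInDistribution W atTop id (fun _ => μ)
      (stdGaussian (EuclideanSpace ℝ (Fin (m + 1) × Fin n))) :=
    tendstoInDistribution_countCoords hX hH0 hp hp0 ha hbs hbp
  have hrlim : TendstoInMeasure μ r atTop fun _ => q := tendstoInMeasure_blockFreq hX hH0 hp d
  have hrmeas : ∀ N, AEMeasurable (r N) μ := fun N =>
    (measurable_of_dependsOn_Iio hX (Φ := fun x (i : Fin d → Fin s) => windowSum d
      (fun i' _ => if i' = i then (1 : ℝ) else 0) N x / N) (t := N + d) fun x y h => by
        simp only [dependsOn_windowSum d _ N h]).aemeasurable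
  have hεlim : TendstoInMeasure μ (fun (N : ℕ) (_ : Ω) => (√(N : ℝ))⁻¹) atTop fun _ => 0 :=
    tendstoInMeasure_of_tendsto_ae (fun _ => aestronglyMeasurable_const)
      (ae_of_all _ fun _ => tendsto_inv_sqrt_natCast)
  set y : EuclideanSpace ℝ (Fin (m + 1) × Fin n) → (Fin d → Fin s) → Fin s → ℝ := fun w i j =>
    √(q i) * √(p j) * tableOfCoords a (fun l : Fin n => b l.succ) (fun k l => w (k, l)) i j with hy
  have hycont : ∀ i j, Continuous fun w => y w i j := fun i j => by
    simp only [hy, tableOfCoords]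
    fun_prop
  have hcont : Continuous fun t : (EuclideanSpace ℝ (Fin (m + 1) × Fin n) ×
      ((Fin d → Fin s) → ℝ)) × ℝ => likelihoodRatioExpansion q p (y t.1.1) t.1.2 t.2 :=
    continuous_likelihoodRatioExpansion hq0 hp0
      (fun i j => (hycont i j).comp (continuous_fst.comp continuous_fst)) (fun i => by fun_prop)
      continuous_snd
  have hexp : TendstoInDistribution
      (fun (N : ℕ) ω => likelihoodRatioExpansion q p (y (W N ω)) (r N ω) (√(N : ℝ))⁻¹) atTop
      (fun w => likelihoodRatioExpansion q p (y w) q 0) (fun _ => μ)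
      (stdGaussian (EuclideanSpace ℝ (Fin (m + 1) × Fin n))) :=
    (hWlim.prodMk_of_tendstoInMeasure_const _ _ _ hrlim
      hrmeas).continuous_comp_prodMk_of_tendstoInMeasure_const hcont hεlim
      fun _ => aemeasurable_const
  -- The statistic agrees with its expansion unless some row frequency is below half its limit.
  obtain ⟨δ, hδ, hδq⟩ : ∃ δ > 0, ∀ i, δ ≤ q i / 2 := by
    have hNe' : Nonempty (Fin d → Fin s) := ⟨fun _ => ⟨0, hs⟩⟩
    obtain ⟨i₀, hi₀⟩ := Finite.exists_min q
    exact ⟨q i₀ / 2, half_pos (hq0 i₀), fun i => by linarith [hi₀ i]⟩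
  have hagree : ∀ (N : ℕ) (ω : Ω), 0 < N → ‖r N ω - q‖ < δ →
      likelihoodRatio d N (fun u => X u ω) =
        likelihoodRatioExpansion q p (y (W N ω)) (r N ω) (√(N : ℝ))⁻¹ := fun N ω hN hω => by
    have hy' : y (W N ω) = fun i j => (√(N : ℝ))⁻¹ * (windowCount d N (fun u => X u ω) i j -
        (∑ j, windowCount d N (fun u => X u ω) i j) * p j) := by
      funext i j
      exact mul_tableOfCoords_countCoords hq0 hp0 hp1 ha' hb' (fun j => by rw [hb0]) hbp N _ i j
    have hr' : r N ω = fun i => (∑ j, windowCount d N (fun u => X u ω) i j) / N := by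
      funext i
      simp only [hr, sum_windowCount_right]
    rw [hy', hr', likelihoodRatio]
    refine likelihoodRatio_eq_expansion (windowCount_nonneg d N _) hq0 hp0 hp1
      (by exact_mod_cast hN) (sum_windowCount d N _) fun i => ?_
    have h1 := (norm_le_pi_norm (r N ω - q) i).trans_lt hω
    rw [Pi.sub_apply, Real.norm_eq_abs, abs_lt] at h1
    have h2 : (∑ j, windowCount d N (fun u => X u ω) i j) / N = r N ω i := by rw [hr']
    rw [h2]
    linarith [hδq i, h1.1]
  have hdiff : TendstoInMeasure μ ((fun (N : ℕ) ω => likelihoodRatio d N fun u => X u ω) -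
      fun (N : ℕ) ω => likelihoodRatioExpansion q p (y (W N ω)) (r N ω) (√(N : ℝ))⁻¹) atTop 0 := by
    rw [tendstoInMeasure_iff_measureReal_norm] at hrlim ⊢
    intro ε hε
    refine squeeze_zero' (Eventually.of_forall fun _ => measureReal_nonneg) ?_ (hrlim δ hδ)
    filter_upwards [eventually_gt_atTop 0] with N hN
    refine measureReal_mono fun ω hω => ?_
    simp only [Set.mem_ofPred_eq] at hω ⊢
    by_contra! hlt
    simp only [Pi.sub_apply, Pi.zero_apply, hagree N ω hN hlt, sub_self, norm_zero] at hω
    exact hω.not_gt hε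
  have hlim := tendstoInDistribution_of_tendstoInMeasure_sub _ _ hexp hdiff fun N =>
    (measurable_of_dependsOn_Iio hX (dependsOn_likelihoodRatio d N)).aemeasurable
  -- At `ε = 0` the expansion is the squared length of the part of `w` with first index nonzero.
  have hquad : (fun w => likelihoodRatioExpansion q p (y w) q 0) =
      fun w => ∑ k : Fin m, ∑ l : Fin n, w (k.succ, l) ^ 2 := by
    funext w
    rw [likelihoodRatioExpansion_zero hq0, ← sum_sq_sub_sum_sq_tableOfCoords ha hbs
      fun k l => w (k, l), ha0]
    congr 1
    · refine Finset.sum_congr rfl fun i _ => Finset.sum_congr rfl fun j _ => ?_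
      simp only [hy]
      rw [mul_pow, mul_pow, Real.sq_sqrt (hq0 i).le, Real.sq_sqrt (hp0 j).le,
        mul_div_cancel_left₀ _ (mul_pos (hq0 i) (hp0 j)).ne']
    · refine Finset.sum_congr rfl fun j _ => ?_
      have h : ∑ i, y w i j = √(p j) * ∑ i, √(q i) *
          tableOfCoords a (fun l : Fin n => b l.succ) (fun k l => w (k, l)) i j := by
        rw [Finset.mul_sum]
        exact Finset.sum_congr rfl fun i _ => by simp only [hy]; ring
      rw [h, mul_pow, Real.sq_sqrt (hp0 j).le, mul_div_cancel_left₀ _ (hp0 j).ne']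
  rw [hquad] at hlim
  refine ⟨hlim.forall_aemeasurable, aemeasurable_id, ?_⟩
  have hlaw : (⟨_, Measure.isProbabilityMeasure_map hlim.aemeasurable_limit⟩ :
      ProbabilityMeasure ℝ) = ⟨_, Measure.isProbabilityMeasure_map aemeasurable_id⟩ :=
    Subtype.ext ((map_stdGaussian_sum_sq_eq_chiSquared m n).trans Measure.map_id.symm)
  exact hlim.tendsto.mono_right (congrArg (nhds (X := ProbabilityMeasure ℝ)) hlaw).le

end

theorem lemma2 {Ω : Type*} [MeasurableSpace Ω] (μ : Measure Ω) [IsProbabilityMeasure μ]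
    (s k : ℕ) (hk : 2 ≤ k) (X : ℕ → Ω → Fin s) (hX : ∀ t, Measurable (X t))
    (hstat : IsStationaryProcess X μ) (hH0 : IsUnpredictable X μ)
    (hpos : ∀ a : Fin s, 0 < μ {ω | X 0 ω = a}) :
    TendstoInDistribution (fun (n : ℕ) (ω : Ω) => npStatistic k n (fun t => X t ω)) atTop
      (id : ℝ → ℝ) (fun _ => μ) (chiSquared ((s ^ (k - 1) - 1) * (s - 1))) := by
  have hp : ∀ t a, μ.real {ω | X t ω = a} = μ.real {ω | X 0 ω = a} := fun t a => by
    have h : μ {ω | X (0 + t) ω = a} = μ {ω | X 0 ω = a} := (hstat t).measure_mem_eq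
      ((measurable_pi_apply (X := fun _ : ℕ => Fin s) 0) (measurableSet_singleton a))
    rw [zero_add] at h
    exact congrArg ENNReal.toReal h
  have hlim := tendstoInDistribution_likelihoodRatio hX hH0 hp
    (fun a => ENNReal.toReal_pos (hpos a).ne' (measure_ne_top μ _)) (k - 1)
  have hshift : Tendsto (fun n => n + 1 - k) atTop atTop :=
    tendsto_atTop_mono (fun n => by omega) (tendsto_sub_atTop_nat k)
  have hmeas : ∀ n, AEMeasurable (fun ω => npStatistic k n fun t => X t ω) μ := fun n =>
    (measurable_of_dependsOn_Iio hX (Φ := npStatistic k n) (t := n + 1 - k + (k - 1))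
      fun x y h => by
        have hc : ∀ i j, (blockCount k n x i j : ℝ) = blockCount k n y i j := fun i j => by
          rw [cast_blockCount, cast_blockCount]
          exact dependsOn_windowSum _ _ _ h
        simp only [npStatistic, colCount, rowCount, Nat.cast_sum, hc]).aemeasurable
  refine ⟨hmeas, aemeasurable_id, (hlim.tendsto.comp hshift).congr' ?_⟩
  filter_upwards [eventually_ge_atTop k] with n hn
  refine Subtype.ext (congrArg (Measure.map · μ) (funext fun ω => ?_))
  exact (npStatistic_eq_likelihoodRatio hn _).symm
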